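/- Let $\mathbb{F}_2=\{0,1\}$ be the field with two elements. A cubic form on $\mathbb{F}_2^n$ is a function $\alpha:\mathbb{F}_2^n\to\mathbb{F}_2$ of the form $\alpha(x)=\sum_{1\le i\le j\le k\le n}\alpha_{ijk}\,x_ix_jx_k$ with coefficients $\alpha_{ijk}\in\mathbb{F}_2$. The Hurwitz–Radon function $\rho$ depends only on the dyadic part of its argument, that is $\rho(2^n(2m+1))=\rho(2^n)$, and $$\rho(2^n)=\begin{cases}2n+1,& n\equiv 0 \pmod 4,\\ 2n,& n\equiv 1,2 \pmod 4,\\ 2n+2,& n\equiv 3 \pmod 4.\end{cases}$$ (i) Let $\alpha$ be any cubic form on $\mathbb{F}_2^n$ and let $A\subset\mathbb{F}_2^n$ be such that $\alpha(x+x')=1$ for all distinct $x,x'\in A$. Then $|A|\le\rho(2^n)$. (ii) This bound is sharp at least when $n\equiv 1,2$ or $3\pmod 4$: for every such $n$ there exist a cubic form $\alpha$ on $\mathbb{F}_2^n$ and a set $A\subset\mathbb{F}_2^n$ with $\alpha(x+x')=1$ for all distinct $x,x'\in A$ and $|A|=\rho(2^n)$. -/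

import Mathlib

/-- A function `α : 𝔽₂ⁿ → 𝔽₂` is a cubic form if
`α x = ∑_{i ≤ j ≤ k} c i j k * x i * x j * x k` for some coefficients `c i j k` in `𝔽₂`. -/
def IsCubicForm {n : ℕ} (α : (Fin n → ZMod 2) → ZMod 2) : Prop :=
  ∃ c : Fin n → Fin n → Fin n → ZMod 2, ∀ x : Fin n → ZMod 2,
    α x = ∑ i : Fin n, ∑ j ∈ Finset.Ici i, ∑ k ∈ Finset.Ici j, c i j k * x i * x j * x k

/-- The Hurwitz-Radon function. If `N = 2 ^ n * (2 * m + 1)`, so that `n = padicValNat 2 N`, its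
value is `2 * n + 1`, `2 * n`, `2 * n` or `2 * n + 2` according as `n` is congruent to
`0`, `1`, `2` or `3` modulo `4`. (The value at `N = 0` is irrelevant.) -/
def hurwitzRadon (N : ℕ) : ℕ :=
  if padicValNat 2 N % 4 = 0 then 2 * padicValNat 2 N + 1
  else if padicValNat 2 N % 4 = 3 then 2 * padicValNat 2 N + 2
  else 2 * padicValNat 2 N

/-! Upper bound: take r points of A and the code of even-weight linear relations among them, of
dimension at least r - n - 1. A cubic parity identity (`sum_erase_eq_sum_pairs`) makes this code
doubly even, hence self-orthogonal, so r ≤ 2n + 2. The Gauss sum ∑ i^wt(s) over the dual code equals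
(1 + i)^r (`sum_dualCode_I_pow`). For r = 2n + 2 the code is self-dual and this forces 4 ∣ n + 1;
for r = 2n + 1 the sign of the real part forces n ≡ 0 or 3 mod 4. Sharpness: a cubic form detecting
whether 4 ∤ wt(x) (`completeCubic`) is evaluated on the unit vectors, with 0 added when n ≡ 3 mod 4,
together with a translate of them. -/

/-- The Hamming weight of a binary vector. -/
def bitWeight {ι : Type*} [Fintype ι] (x : ι → ZMod 2) : ℕ := ∑ i, (x i).val

section bitWeight

variable {ι : Type*} [Fintype ι]

theorem bitWeight_add (x y : ι → ZMod 2) :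
    bitWeight (x + y) + 2 * bitWeight (x * y) = bitWeight x + bitWeight y := by
  have key : ∀ a b : ZMod 2, (a + b).val + 2 * (a * b).val = a.val + b.val := by decide
  simp only [bitWeight, Finset.mul_sum, ← Finset.sum_add_distrib, Pi.add_apply, Pi.mul_apply, key]

theorem bitWeight_cast (x : ι → ZMod 2) : (bitWeight x : ZMod 2) = ∑ i, x i := by
  simp [bitWeight]

theorem bitWeight_mul_cast (x y : ι → ZMod 2) : (bitWeight (x * y) : ZMod 2) = x ⬝ᵥ y := by
  rw [bitWeight_cast]; rfl

@[simp] theorem bitWeight_zero : bitWeight (0 : ι → ZMod 2) = 0 := by simp [bitWeight]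

theorem bitWeight_single [DecidableEq ι] (i : ι) :
    bitWeight (Pi.single i 1 : ι → ZMod 2) = 1 := by
  unfold bitWeight
  rw [Finset.sum_eq_single i]
  · simp [ZMod.val_one]
  · intro j _ h
    simp [h]
  · simp

theorem bitWeight_eq_card_support (x : ι → ZMod 2) :
    bitWeight x = (Finset.univ.filter fun i => x i = 1).card := by
  have key : ∀ a : ZMod 2, a.val = if a = 1 then 1 else 0 := by decide
  simp [bitWeight, key]

end bitWeight

/-! ### Doubly even codes and their Gauss sum. -/

section codes

variable {ι : Type*} [Fintype ι]

/-- The dual of a binary code. -/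
def dualCode (C : Submodule (ZMod 2) (ι → ZMod 2)) : Submodule (ZMod 2) (ι → ZMod 2) where
  carrier := {s | ∀ c ∈ C, c ⬝ᵥ s = 0}
  add_mem' hs ht c hc := by rw [dotProduct_add, hs c hc, ht c hc, add_zero]
  zero_mem' c _ := dotProduct_zero c
  smul_mem' a s hs c hc := by rw [dotProduct_smul, hs c hc, smul_zero]

theorem finrank_add_finrank_dualCode [DecidableEq ι] (C : Submodule (ZMod 2) (ι → ZMod 2)) :
    Module.finrank (ZMod 2) C + Module.finrank (ZMod 2) (dualCode C) = Fintype.card ι := by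
  have h := LinearMap.BilinForm.finrank_add_finrank_orthogonal'
    (B := (dotProductBilin (ZMod 2) (ZMod 2) : LinearMap.BilinForm (ZMod 2) (ι → ZMod 2))) C
  have hker : LinearMap.ker
      (dotProductBilin (ZMod 2) (ZMod 2) : LinearMap.BilinForm (ZMod 2) (ι → ZMod 2)) = ⊥ := by
    rw [LinearMap.ker_eq_bot']
    intro x hx
    ext i
    simpa [dotProductBilin] using LinearMap.congr_fun hx (Pi.single i 1)
  rw [hker, inf_bot_eq, finrank_bot, add_zero, Module.finrank_fintype_fun_eq_card] at h
  exact h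

/-- By `bitWeight_add`, twice the overlap of two codewords is divisible by 4, so the overlap is
even. -/
theorem le_dualCode_of_doublyEven {C : Submodule (ZMod 2) (ι → ZMod 2)}
    (hC : ∀ c ∈ C, 4 ∣ bitWeight c) : C ≤ dualCode C := by
  intro s hs c hc
  rw [← bitWeight_mul_cast, ZMod.natCast_eq_zero_iff]
  have := bitWeight_add c s
  have h1 := hC _ hc
  have h2 := hC _ hs
  have h3 := hC _ (C.add_mem hc hs)
  omega

theorem sum_I_pow_bitWeight [DecidableEq ι] :
    ∑ s : ι → ZMod 2, Complex.I ^ bitWeight s = (1 + Complex.I) ^ Fintype.card ι := by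
  have h : ∑ b : ZMod 2, Complex.I ^ b.val = 1 + Complex.I := by
    rw [show (Finset.univ : Finset (ZMod 2)) = {0, 1} from rfl]
    simp [ZMod.val_one]
  have := Finset.prod_univ_sum (fun _ : ι => (Finset.univ : Finset (ZMod 2)))
    (fun _ b => Complex.I ^ b.val)
  rw [Fintype.piFinset_univ] at this
  simp only [h, Finset.prod_const, Finset.card_univ] at this
  rw [this]
  simp [bitWeight, Finset.prod_pow_eq_pow_sum]

/-- A nontrivial character sums to zero: translating by a codeword not orthogonal to s flips every
sign. -/
theorem sum_neg_one_pow_eq_zero {C : Submodule (ZMod 2) (ι → ZMod 2)} [Fintype C]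
    {s : ι → ZMod 2} (hs : s ∉ dualCode C) :
    ∑ c : C, (-1 : ℂ) ^ bitWeight (s * (c : ι → ZMod 2)) = 0 := by
  have : ∃ c ∈ C, ¬ c ⬝ᵥ s = 0 := by
    by_contra! h
    exact hs h
  obtain ⟨c, hc, hcs⟩ := this
  have h1 : c ⬝ᵥ s = 1 := by
    generalize c ⬝ᵥ s = a at *
    revert hcs; revert a; decide
  have odd : bitWeight (s * c) % 2 = 1 := by
    rw [dotProduct_comm, ← bitWeight_mul_cast, ZMod.natCast_eq_one_iff_odd] at h1
    exact Nat.odd_iff.mp h1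
  have shift := Equiv.sum_comp (Equiv.addLeft (⟨c, hc⟩ : C))
    (fun d : C => (-1 : ℂ) ^ bitWeight (s * (d : ι → ZMod 2)))
  have flip : ∀ d : C, (-1 : ℂ) ^ bitWeight (s * ((Equiv.addLeft (⟨c, hc⟩ : C) d : C) : ι → ZMod 2))
      = - (-1 : ℂ) ^ bitWeight (s * (d : ι → ZMod 2)) := by
    intro d
    have e := bitWeight_add (s * c) (s * (d : ι → ZMod 2))
    rw [← mul_add] at e
    change (-1 : ℂ) ^ bitWeight (s * (c + (d : ι → ZMod 2))) = _
    rw [show ∀ m : ℕ, -(-1 : ℂ) ^ m = (-1) ^ (m + 1) from fun m => by ring]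
    rw [neg_one_pow_eq_pow_mod_two, neg_one_pow_eq_pow_mod_two (n := _ + 1)]
    congr 1
    omega
  simp only [flip, Finset.sum_neg_distrib] at shift
  exact self_eq_neg.mp shift.symm

/-- The Gauss sum of a doubly even code. -/
theorem sum_dualCode_I_pow [DecidableEq ι] {C : Submodule (ZMod 2) (ι → ZMod 2)}
    (hC : ∀ c ∈ C, 4 ∣ bitWeight c) [Fintype (dualCode C)] :
    ∑ s : dualCode C, Complex.I ^ bitWeight (s : ι → ZMod 2)
      = (1 + Complex.I) ^ Fintype.card ι := by
  classical
  -- Summing over all translates by C gives |C| (1 + i)^r; exchanging the sums leaves only the s in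
  -- the dual code.
  have shift : ∀ c : C, ∑ s : ι → ZMod 2, Complex.I ^ bitWeight (s + (c : ι → ZMod 2))
      = (1 + Complex.I) ^ Fintype.card ι := fun c => by
    rw [← sum_I_pow_bitWeight]
    exact Equiv.sum_comp (Equiv.addRight (c : ι → ZMod 2)) (fun s => Complex.I ^ bitWeight s)
  have expand : ∀ (s : ι → ZMod 2) (c : C), Complex.I ^ bitWeight (s + (c : ι → ZMod 2))
      = Complex.I ^ bitWeight s * (-1) ^ bitWeight (s * (c : ι → ZMod 2)) := by
    intro s c
    obtain ⟨k, hk⟩ := hC c c.2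
    have e := bitWeight_add s (c : ι → ZMod 2)
    have sq : ((-1 : ℂ) ^ bitWeight (s * (c : ι → ZMod 2))) ^ 2 = 1 := by
      rw [← pow_mul, mul_comm, pow_mul]; simp
    have := congrArg (fun k => Complex.I ^ k) e
    simp only [pow_add, pow_mul, hk, Complex.I_pow_four, Complex.I_sq, one_pow, mul_one] at this
    rw [← this, mul_assoc, ← pow_two, sq, mul_one]
  have total := Finset.sum_congr rfl fun (c : C) (_ : c ∈ Finset.univ) => shift c
  rw [Finset.sum_comm] at total
  simp only [expand, ← Finset.mul_sum, Finset.sum_const, Finset.card_univ, nsmul_eq_mul] at total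
  have inner : ∀ s : ι → ZMod 2, Complex.I ^ bitWeight s *
      ∑ c : C, (-1 : ℂ) ^ bitWeight (s * (c : ι → ZMod 2))
      = if s ∈ dualCode C then Fintype.card C * Complex.I ^ bitWeight s else 0 := by
    intro s
    split_ifs with h
    · have : ∀ c : C, (-1 : ℂ) ^ bitWeight (s * (c : ι → ZMod 2)) = 1 := by
        intro c
        refine Even.neg_one_pow ?_
        rw [← ZMod.natCast_eq_zero_iff_even, bitWeight_mul_cast, dotProduct_comm]
        exact h c c.2
      simp [this, mul_comm]
    · rw [sum_neg_one_pow_eq_zero h, mul_zero]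
  simp only [inner] at total
  rw [← Finset.sum_filter, ← Finset.mul_sum] at total
  have hne : (Fintype.card C : ℂ) ≠ 0 := by
    exact_mod_cast Fintype.card_ne_zero
  rw [← mul_left_cancel₀ hne total]
  rw [Finset.sum_subtype _ (p := fun s => s ∈ dualCode C) (by simp)]

end codes

/-! ### The parity identity for cubic functions of a subset. -/

/-- Among the pairs in a set `S` of odd size, the number containing `{j, k, l}` has the same
parity as the number of points of `S` outside `{j, k, l}`. -/
theorem card_pairs_superset_cast {ι : Type*} [DecidableEq ι] {S T : Finset ι} (hS : Odd S.card)
    (hT : T ⊆ S) (hne : T.Nonempty) (h3 : T.card ≤ 3) :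
    (((S.powersetCard 2).filter (T ⊆ ·)).card : ZMod 2) = ((S.filter (· ∉ T)).card : ZMod 2) := by
  have hout : (S.filter (· ∉ T)).card + T.card = S.card := by
    rw [← Finset.sdiff_eq_filter, Finset.card_sdiff_add_card_eq_card hT]
  rw [ZMod.natCast_eq_natCast_iff']
  have hpos := hne.card_pos
  have hodd := Nat.odd_iff.mp hS
  -- For |T| = 1, 2, 3 the pair counts are |S| - 1, 1 and 0, which agree mod 2 with |S| - |T|
  -- because |S| is odd.
  rcases (by omega : T.card = 1 ∨ T.card = 2 ∨ T.card = 3) with h | h | h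
  · obtain ⟨j, rfl⟩ := Finset.card_eq_one.mp h
    have hj : j ∈ S := by simpa using hT
    have : (S.powersetCard 2).filter (({j} : Finset ι) ⊆ ·)
        = (S.erase j).image (fun k => {j, k}) := by
      ext p
      simp only [Finset.mem_filter, Finset.mem_powersetCard, Finset.singleton_subset_iff,
        Finset.mem_image, Finset.mem_erase]
      constructor
      · rintro ⟨⟨hp, hc⟩, hjp⟩
        obtain ⟨k, hk⟩ := Finset.card_eq_one.mp
          (show (p.erase j).card = 1 by rw [Finset.card_erase_of_mem hjp, hc])
        have hk' : k ∈ p.erase j := by simp [hk]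
        rw [Finset.mem_erase] at hk'
        exact ⟨k, ⟨hk'.1, hp hk'.2⟩, by rw [← hk, Finset.insert_erase hjp]⟩
      · rintro ⟨k, ⟨hk, hkS⟩, rfl⟩
        refine ⟨⟨?_, Finset.card_pair hk.symm⟩, by simp⟩
        intro x hx
        simp only [Finset.mem_insert, Finset.mem_singleton] at hx
        rcases hx with rfl | rfl <;> assumption
    rw [this, Finset.card_image_of_injOn, Finset.card_erase_of_mem hj]
    · omega
    · intro k hk l hl e
      have hk' : k ≠ j := by simpa using (Finset.mem_erase.mp hk).1
      have : k ∈ ({j, l} : Finset ι) := by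
        rw [← show ({j, k} : Finset ι) = {j, l} from e]; simp
      simpa [hk'] using this
  · have : (S.powersetCard 2).filter (T ⊆ ·) = {T} := by
      ext p
      simp only [Finset.mem_filter, Finset.mem_powersetCard, Finset.mem_singleton]
      constructor
      · rintro ⟨⟨-, hc⟩, hTp⟩
        exact (Finset.eq_of_subset_of_card_le hTp (by omega)).symm
      · rintro rfl
        exact ⟨⟨hT, h⟩, subset_rfl⟩
    rw [this, Finset.card_singleton]
    omega
  · have : (S.powersetCard 2).filter (T ⊆ ·) = ∅ := by
      ext p
      simp only [Finset.mem_filter, Finset.mem_powersetCard, Finset.notMem_empty, iff_false]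
      rintro ⟨⟨-, hc⟩, hTp⟩
      have := Finset.card_le_card hTp
      omega
    rw [this, Finset.card_empty]
    omega

/-- For a cubic polynomial function on the subsets of a set `S` of odd size, the sum over
complements of points equals the sum over pairs, modulo `2`. -/
theorem sum_erase_eq_sum_pairs {ι : Type*} [DecidableEq ι] {S : Finset ι} (hS : Odd S.card)
    (g : ι → ι → ι → ZMod 2) :
    ∑ i ∈ S, ∑ j ∈ S.erase i, ∑ k ∈ S.erase i, ∑ l ∈ S.erase i, g j k l
      = ∑ p ∈ S.powersetCard 2, ∑ j ∈ p, ∑ k ∈ p, ∑ l ∈ p, g j k l := by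
  have restrict : ∀ T ⊆ S, ∑ j ∈ T, ∑ k ∈ T, ∑ l ∈ T, g j k l
      = ∑ t ∈ S ×ˢ S ×ˢ S, if ({t.1, t.2.1, t.2.2} : Finset ι) ⊆ T then g t.1 t.2.1 t.2.2 else 0 := by
    intro T hT
    have : (S ×ˢ S ×ˢ S).filter (fun t => ({t.1, t.2.1, t.2.2} : Finset ι) ⊆ T)
        = T ×ˢ T ×ˢ T := by
      ext ⟨j, k, l⟩
      simp only [Finset.mem_product, Finset.mem_filter, Finset.insert_subset_iff,
        Finset.singleton_subset_iff]
      exact ⟨fun h => h.2, fun h => ⟨⟨hT h.1, hT h.2.1, hT h.2.2⟩, h⟩⟩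
    rw [← Finset.sum_filter, this]
    simp only [Finset.sum_product]
  rw [Finset.sum_congr rfl fun i _ => restrict _ (Finset.erase_subset i S),
    Finset.sum_congr rfl fun p hp => restrict p (Finset.mem_powersetCard.mp hp).1,
    Finset.sum_comm, Finset.sum_comm (s := S.powersetCard 2)]
  refine Finset.sum_congr rfl fun ⟨j, k, l⟩ ht => ?_
  simp only [Finset.mem_product] at ht
  have hT : ({j, k, l} : Finset ι) ⊆ S := by
    simpa [Finset.insert_subset_iff] using ht
  have h := card_pairs_superset_cast hS hT (by simp) Finset.card_le_three
  simp only [← Finset.sum_filter, Finset.sum_const, nsmul_eq_mul, h]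
  congr 3
  refine Finset.filter_congr fun i _ => ?_
  rw [Finset.subset_erase]
  exact and_iff_right hT

/-! ### Linear relations and cubic forms. -/

section cubic

variable {n : ℕ}

theorem binary_add_self (x : Fin n → ZMod 2) : x + x = 0 :=
  funext fun i => CharTwo.add_self_eq_zero (x i)

/-- A cubic form is the diagonal of a trilinear form, hence expands over sums of vectors. -/
theorem IsCubicForm.exists_sum_expansion {α : (Fin n → ZMod 2) → ZMod 2} (hα : IsCubicForm α)
    {ι : Type*} (b : ι → Fin n → ZMod 2) :
    ∃ g : ι → ι → ι → ZMod 2, ∀ T : Finset ι,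
      α (∑ i ∈ T, b i) = ∑ j ∈ T, ∑ k ∈ T, ∑ l ∈ T, g j k l := by
  obtain ⟨c, hc⟩ := hα
  refine ⟨fun j k l => ∑ x : Fin n, ∑ y ∈ Finset.Ici x, ∑ z ∈ Finset.Ici y,
    c x y z * b j x * b k y * b l z, fun T => ?_⟩
  rw [hc]
  have e1 : ∀ x y z, c x y z * (∑ i ∈ T, b i) x * (∑ i ∈ T, b i) y * (∑ i ∈ T, b i) z
      = ∑ j ∈ T, ∑ k ∈ T, ∑ l ∈ T, c x y z * b j x * b k y * b l z := by
    intro x y z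
    simp only [← Finset.mul_sum, ← Finset.sum_mul, Finset.sum_apply]
  have swap : ∀ (s : Finset (Fin n)) (f : Fin n → ι → ι → ι → ZMod 2),
      ∑ j ∈ T, ∑ k ∈ T, ∑ l ∈ T, ∑ x ∈ s, f x j k l
        = ∑ x ∈ s, ∑ j ∈ T, ∑ k ∈ T, ∑ l ∈ T, f x j k l := by
    intro s f
    rw [Finset.sum_comm (s := s)]
    refine Finset.sum_congr rfl fun j _ => ?_
    rw [Finset.sum_comm (s := s)]
    exact Finset.sum_congr rfl fun k _ => Finset.sum_comm
  simp only [e1, swap]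

theorem IsCubicForm.map_zero {α : (Fin n → ZMod 2) → ZMod 2} (hα : IsCubicForm α) : α 0 = 0 := by
  obtain ⟨c, hc⟩ := hα
  simp [hc]

/-- As the b i sum to zero, omitting one leaves b i itself. The parity identity then reads |S| ≡
|S|(|S| - 1)/2 mod 2. -/
theorem card_mod_four_of_sum_eq_zero {α : (Fin n → ZMod 2) → ZMod 2} (hα : IsCubicForm α)
    {ι : Type*} [DecidableEq ι] {b : ι → Fin n → ZMod 2} {S : Finset ι} (hS : Odd S.card)
    (h1 : ∀ i ∈ S, α (b i) = 1) (h2 : ∀ i ∈ S, ∀ j ∈ S, i ≠ j → α (b i + b j) = 1)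
    (h0 : ∑ i ∈ S, b i = 0) : S.card % 4 = 3 := by
  obtain ⟨g, hg⟩ := hα.exists_sum_expansion b
  have h := sum_erase_eq_sum_pairs hS g
  simp only [← hg] at h
  have hl : ∀ i ∈ S, α (∑ j ∈ S.erase i, b j) = 1 := by
    intro i hi
    rw [← h1 i hi]
    rw [← Finset.add_sum_erase S b hi] at h0
    rw [eq_neg_of_add_eq_zero_right h0, neg_eq_of_add_eq_zero_left (binary_add_self _)]
  have hr : ∀ p ∈ S.powersetCard 2, α (∑ j ∈ p, b j) = 1 := by
    intro p hp
    rw [Finset.mem_powersetCard] at hp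
    obtain ⟨x, y, hxy, rfl⟩ := Finset.card_eq_two.mp hp.2
    rw [Finset.sum_pair hxy]
    exact h2 x (hp.1 (by simp)) y (hp.1 (by simp)) hxy
  rw [Finset.sum_congr rfl hl, Finset.sum_congr rfl hr] at h
  simp only [Finset.sum_const, Finset.card_powersetCard, nsmul_eq_mul, mul_one] at h
  rw [ZMod.natCast_eq_natCast_iff', Nat.choose_two_right] at h
  obtain ⟨k, hk⟩ := hS
  rw [hk] at h ⊢
  have : (2 * k + 1) * (2 * k + 1 - 1) / 2 = 2 * (k * k) + k := by
    rw [Nat.add_sub_cancel, show (2 * k + 1) * (2 * k) = 2 * (2 * (k * k) + k) by ring,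
      Nat.mul_div_cancel_left _ (by norm_num)]
  omega

/-- Translating by one point of S sends it to 0 and leaves an odd family whose members and pairwise
sums all have value 1. -/
theorem four_dvd_card_of_sum_eq_zero {α : (Fin n → ZMod 2) → ZMod 2} (hα : IsCubicForm α)
    {ι : Type*} [DecidableEq ι] {a : ι → Fin n → ZMod 2}
    (ha : ∀ i j, i ≠ j → α (a i + a j) = 1) {S : Finset ι} (hS : Even S.card)
    (h0 : ∑ i ∈ S, a i = 0) : 4 ∣ S.card := by
  rcases S.eq_empty_or_nonempty with rfl | ⟨i, hi⟩
  · simp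
  have hcard := Finset.card_erase_add_one hi
  have hodd : Odd (S.erase i).card := by
    rw [← hcard] at hS
    exact Nat.not_even_iff_odd.mp fun h => Nat.not_even_iff_odd.mpr h.add_one hS
  have := card_mod_four_of_sum_eq_zero hα (b := fun j => a j + a i) hodd
    (fun j hj => ha j i (Finset.ne_of_mem_erase hj))
    (fun j _ k _ hjk => by
      rw [add_add_add_comm, binary_add_self, add_zero]
      exact ha j k hjk)
    (by
      rw [Finset.sum_add_distrib, Finset.sum_const, ← Nat.cast_smul_eq_nsmul (ZMod 2),
        (ZMod.natCast_eq_one_iff_odd).mpr hodd, one_smul, Finset.sum_erase_add _ _ hi, h0])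
  omega

end cubic

/-! ### The upper bound. -/

section upper

variable {n : ℕ} {ι : Type*} [Fintype ι]

/-- The even-weight binary relations among a family of binary vectors. -/
def evenRelations (a : ι → Fin n → ZMod 2) : Submodule (ZMod 2) (ι → ZMod 2) :=
  LinearMap.ker ((Fintype.linearCombination (ZMod 2) (fun _ : ι => (1 : ZMod 2))).prod
    (Fintype.linearCombination (ZMod 2) a))

theorem mem_evenRelations {a : ι → Fin n → ZMod 2} {c : ι → ZMod 2} :
    c ∈ evenRelations a ↔ ∑ i, c i = 0 ∧ ∑ i, c i • a i = 0 := by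
  simp [evenRelations, Fintype.linearCombination_apply]

theorem card_le_finrank_evenRelations (a : ι → Fin n → ZMod 2) :
    Fintype.card ι ≤ Module.finrank (ZMod 2) (evenRelations a) + (n + 1) := by
  let L := (Fintype.linearCombination (ZMod 2) (fun _ : ι => (1 : ZMod 2))).prod
    (Fintype.linearCombination (ZMod 2) a)
  have h := L.finrank_range_add_finrank_ker
  have h' := (LinearMap.range L).finrank_le
  simp only [Module.finrank_fintype_fun_eq_card, Module.finrank_prod, Module.finrank_self,
    Fintype.card_fin] at h h'
  change _ + Module.finrank (ZMod 2) (evenRelations a) = _ at h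
  omega

theorem four_dvd_bitWeight_of_mem_evenRelations {α : (Fin n → ZMod 2) → ZMod 2}
    (hα : IsCubicForm α) {a : ι → Fin n → ZMod 2} (ha : ∀ i j, i ≠ j → α (a i + a j) = 1) :
    ∀ c ∈ evenRelations a, 4 ∣ bitWeight c := by
  classical
  intro c hc
  rw [mem_evenRelations] at hc
  have hw := bitWeight_eq_card_support c
  rw [hw]
  refine four_dvd_card_of_sum_eq_zero hα ha ?_ ?_
  · rw [← hw, ← ZMod.natCast_eq_zero_iff_even, bitWeight_cast, hc.1]
  · rw [Finset.sum_filter]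
    refine (Finset.sum_congr rfl fun i _ => ?_).trans hc.2
    have : c i = 0 ∨ c i = 1 := by generalize c i = t; revert t; decide
    rcases this with h | h <;> simp [h]

theorem card_submodule_zmod_two {ι : Type*} [Fintype ι] (C : Submodule (ZMod 2) (ι → ZMod 2))
    [Fintype C] : Fintype.card C = 2 ^ Module.finrank (ZMod 2) C := by
  rw [Module.card_eq_pow_finrank (K := ZMod 2), ZMod.card]

theorem one_add_I_pow_two_mul (m : ℕ) :
    (1 + Complex.I) ^ (2 * m) = (2 : ℂ) ^ m * Complex.I ^ m := by
  rw [pow_mul, ← mul_pow]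
  congr 1
  ring_nf
  simp

/-- A doubly even code of length `2k` and dimension at least `k` exists only if `4 ∣ k`. -/
theorem four_dvd_of_doublyEven_selfDual {C : Submodule (ZMod 2) (ι → ZMod 2)} {k : ℕ}
    (hC : ∀ c ∈ C, 4 ∣ bitWeight c) (hι : Fintype.card ι = 2 * k)
    (hk : k ≤ Module.finrank (ZMod 2) C) : k % 4 = 0 := by
  classical
  have hle := le_dualCode_of_doublyEven hC
  have hdim := finrank_add_finrank_dualCode C
  have heq : C = dualCode C := Submodule.eq_of_le_of_finrank_le hle (by omega)
  have hsum := sum_dualCode_I_pow hC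
  have hone : ∀ s : dualCode C, Complex.I ^ bitWeight (s : ι → ZMod 2) = 1 := by
    rintro ⟨s, hs⟩
    rw [← heq] at hs
    obtain ⟨t, ht⟩ := hC s hs
    simp [ht, pow_mul]
  rw [hι, one_add_I_pow_two_mul] at hsum
  simp only [hone, Finset.sum_const, Finset.card_univ, card_submodule_zmod_two, ← heq,
    nsmul_eq_mul, mul_one] at hsum
  rw [show Module.finrank (ZMod 2) C = k by rw [← heq] at hdim; omega] at hsum
  push_cast at hsum
  have h2 : Complex.I ^ k = 1 := by
    refine mul_left_cancel₀ (pow_ne_zero k (two_ne_zero (α := ℂ))) ?_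
    rw [← hsum, mul_one]
  rw [← Nat.div_add_mod k 4, pow_add, pow_mul, Complex.I_pow_four, one_pow, one_mul] at h2
  have hlt := Nat.mod_lt k (show 4 > 0 by norm_num)
  interval_cases k % 4
  · rfl
  · simp [Complex.ext_iff] at h2
  · norm_num [Complex.I_sq] at h2
  · simp [pow_succ, Complex.ext_iff] at h2

/-- A doubly even code of length `2k + 1` and dimension at least `k` exists only if `k` is
`0` or `3` modulo `4`. -/
theorem mod_four_of_doublyEven_odd {C : Submodule (ZMod 2) (ι → ZMod 2)} {k : ℕ}
    (hC : ∀ c ∈ C, 4 ∣ bitWeight c) (hι : Fintype.card ι = 2 * k + 1)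
    (hk : k ≤ Module.finrank (ZMod 2) C) : k % 4 = 0 ∨ k % 4 = 3 := by
  classical
  have hle := le_dualCode_of_doublyEven hC
  have hdim := finrank_add_finrank_dualCode C
  have hfin := Submodule.finrank_mono hle
  have hCk : Module.finrank (ZMod 2) C = k := by omega
  have hDk : Module.finrank (ZMod 2) (dualCode C) = k + 1 := by omega
  have hsum := congrArg Complex.re (sum_dualCode_I_pow hC)
  have hre : 0 ≤ (∑ s : dualCode C, Complex.I ^ bitWeight (s : ι → ZMod 2)).re := by
    rw [Complex.re_sum]
    -- The term is 1 on C and at least -1 elsewhere; C is half of its dual, so the lower bounds sum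
    -- to 0.
    have bound : ∀ s : dualCode C, (if (s : ι → ZMod 2) ∈ C then (2 : ℝ) else 0) - 1
        ≤ (Complex.I ^ bitWeight (s : ι → ZMod 2)).re := by
      rintro ⟨s, hs⟩
      split_ifs with h
      · obtain ⟨t, ht⟩ := hC s h
        norm_num [ht, pow_mul]
      · have := Complex.abs_re_le_norm (Complex.I ^ bitWeight s)
        rw [norm_pow, Complex.norm_I, one_pow] at this
        have := (abs_le.mp this).1
        simpa using this
    refine le_trans (le_of_eq ?_) (Finset.sum_le_sum fun s _ => bound s)
    have hcard : (Finset.univ.filter fun s : dualCode C => (s : ι → ZMod 2) ∈ C).card = 2 ^ k := by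
      rw [← hCk, ← card_submodule_zmod_two C, ← Fintype.card_subtype]
      exact Fintype.card_congr (Submodule.submoduleOfEquivOfLe hle).toEquiv
    rw [Finset.sum_sub_distrib, ← Finset.sum_filter, Finset.sum_const, hcard, Finset.sum_const,
      Finset.card_univ, card_submodule_zmod_two, hDk]
    simp only [nsmul_eq_mul]
    push_cast
    ring
  rw [hsum, hι, pow_succ, one_add_I_pow_two_mul, ← Nat.div_add_mod k 4, pow_add Complex.I, pow_mul,
    Complex.I_pow_four, one_pow, one_mul, mul_assoc, ← Complex.ofReal_ofNat, ← Complex.ofReal_pow,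
    Complex.re_ofReal_mul] at hre
  have hre' := nonneg_of_mul_nonneg_right hre (by positivity)
  have hlt := Nat.mod_lt k (show 4 > 0 by norm_num)
  interval_cases k % 4
  · simp
  · norm_num at hre'
  · norm_num [Complex.I_sq] at hre'
  · simp

theorem card_le_hurwitzRadon {α : (Fin n → ZMod 2) → ZMod 2} {A : Finset (Fin n → ZMod 2)}
    (hα : IsCubicForm α) (hA : ∀ x ∈ A, ∀ x' ∈ A, x ≠ x' → α (x + x') = 1) :
    A.card ≤ hurwitzRadon (2 ^ n) := by
  -- Passing to subfamilies of exact size r = 2n + 1, 2n + 2 or 2n + 3 keeps length and dimension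
  -- tightly matched.
  have sub : ∀ r ≤ A.card, ∃ C : Submodule (ZMod 2) (Fin r → ZMod 2),
      (∀ c ∈ C, 4 ∣ bitWeight c) ∧ r ≤ Module.finrank (ZMod 2) C + (n + 1) := by
    intro r hr
    let a : Fin r → Fin n → ZMod 2 := fun i => (A.equivFin.symm (Fin.castLE hr i) : Fin n → ZMod 2)
    have hinj : Function.Injective a := Subtype.val_injective.comp
      (A.equivFin.symm.injective.comp (Fin.castLE_injective hr))
    refine ⟨evenRelations a, four_dvd_bitWeight_of_mem_evenRelations hα fun i j hij => ?_, ?_⟩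
    · exact hA _ (Subtype.prop _) _ (Subtype.prop _) (hinj.ne hij)
    · simpa using card_le_finrank_evenRelations a
  have h3 : A.card < 2 * n + 3 := by
    by_contra! h
    obtain ⟨C, hC, hr⟩ := sub _ h
    have := finrank_add_finrank_dualCode C
    have := Submodule.finrank_mono (le_dualCode_of_doublyEven hC)
    rw [Fintype.card_fin] at *
    omega
  have h2 : 2 * n + 2 ≤ A.card → (n + 1) % 4 = 0 := by
    intro h
    obtain ⟨C, hC, hr⟩ := sub _ h
    exact four_dvd_of_doublyEven_selfDual hC (by rw [Fintype.card_fin]; ring) (by omega)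
  have h1 : 2 * n + 1 ≤ A.card → n % 4 = 0 ∨ n % 4 = 3 := by
    intro h
    obtain ⟨C, hC, hr⟩ := sub _ h
    exact mod_four_of_doublyEven_odd hC (by rw [Fintype.card_fin]) (by omega)
  simp only [hurwitzRadon, padicValNat.prime_pow]
  split_ifs <;> omega

end upper

/-! ### Extremal configurations. -/

section construction

variable {n : ℕ}

theorem IsCubicForm.add {α β : (Fin n → ZMod 2) → ZMod 2} (hα : IsCubicForm α)
    (hβ : IsCubicForm β) : IsCubicForm fun x => α x + β x := by
  obtain ⟨c, hc⟩ := hα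
  obtain ⟨d, hd⟩ := hβ
  exact ⟨fun i j k => c i j k + d i j k, fun x => by
    simp only [hc, hd, add_mul, Finset.sum_add_distrib]⟩

theorem isCubicForm_zero : IsCubicForm fun _ : Fin n → ZMod 2 => 0 :=
  ⟨fun _ _ _ => 0, fun x => by simp⟩

theorem IsCubicForm.sum {κ : Type*} (T : Finset κ) {α : κ → (Fin n → ZMod 2) → ZMod 2}
    (hα : ∀ t ∈ T, IsCubicForm (α t)) : IsCubicForm fun x => ∑ t ∈ T, α t x := by
  classical
  induction T using Finset.induction_on with
  | empty => simpa using isCubicForm_zero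
  | insert t T ht ih =>
    simp only [Finset.sum_insert ht]
    exact (hα t (by simp)).add (ih fun s hs => hα s (by simp [hs]))

theorem isCubicForm_monomial_of_le {a b c : Fin n} (hab : a ≤ b) (hbc : b ≤ c) :
    IsCubicForm fun x : Fin n → ZMod 2 => x a * x b * x c := by
  refine ⟨fun i j k => if i = a then if j = b then if k = c then 1 else 0 else 0 else 0,
    fun x => ?_⟩
  simp [ite_mul, hab, hbc, Finset.sum_ite_eq', Finset.sum_ite_irrel]

theorem isCubicForm_monomial (a b c : Fin n) :
    IsCubicForm fun x : Fin n → ZMod 2 => x a * x b * x c := by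
  rcases le_total a b with h1 | h1 <;> rcases le_total b c with h2 | h2 <;>
    rcases le_total a c with h3 | h3
  · exact isCubicForm_monomial_of_le h1 h2
  · exact isCubicForm_monomial_of_le h1 h2
  · simpa only [mul_comm, mul_left_comm] using isCubicForm_monomial_of_le h3 h2
  · simpa only [mul_comm, mul_left_comm] using isCubicForm_monomial_of_le h3 h1
  · simpa only [mul_comm, mul_left_comm] using isCubicForm_monomial_of_le h1 h3
  · simpa only [mul_comm, mul_left_comm] using isCubicForm_monomial_of_le h2 h3
  · simpa only [mul_comm, mul_left_comm] using isCubicForm_monomial_of_le h2 h1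
  · simpa only [mul_comm, mul_left_comm] using isCubicForm_monomial_of_le h2 h1

/-- The binomial counts the d-subsets of the support, so it is an elementary symmetric polynomial;
u² = u raises lower degrees to 3. -/
theorem isCubicForm_choose_bitWeight {d : ℕ} (hd : 1 ≤ d) (hd3 : d ≤ 3) :
    IsCubicForm fun x : Fin n → ZMod 2 => ((bitWeight x).choose d : ZMod 2) := by
  have expand : ∀ x : Fin n → ZMod 2, ((bitWeight x).choose d : ZMod 2)
      = ∑ t ∈ Finset.univ.powersetCard d, ∏ i ∈ t, x i := by
    intro x
    have key : ∀ t : Finset (Fin n), ∏ i ∈ t, x i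
        = if t ⊆ Finset.univ.filter (fun i => x i = 1) then 1 else 0 := by
      intro t
      split_ifs with h
      · exact Finset.prod_eq_one fun i hi => (Finset.mem_filter.mp (h hi)).2
      · rw [Finset.not_subset] at h
        obtain ⟨i, hi, hx⟩ := h
        refine Finset.prod_eq_zero hi ?_
        have hx' : x i ≠ 1 := by simpa using hx
        generalize x i = u at hx'
        revert u; decide
    rw [bitWeight_eq_card_support, ← Finset.card_powersetCard]
    simp only [key, ← Finset.sum_filter, Finset.sum_const, nsmul_eq_mul, mul_one]
    congr 2
    ext t
    simp [Finset.mem_powersetCard, and_comm]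
  simp only [expand]
  refine IsCubicForm.sum _ fun t ht => ?_
  rw [Finset.mem_powersetCard] at ht
  have idem : ∀ u : ZMod 2, u * u = u := by decide
  rcases (by omega : d = 1 ∨ d = 2 ∨ d = 3) with rfl | rfl | rfl
  · obtain ⟨a, rfl⟩ := Finset.card_eq_one.mp ht.2
    simpa [idem] using isCubicForm_monomial a a a
  · obtain ⟨a, b, hab, rfl⟩ := Finset.card_eq_two.mp ht.2
    simpa [idem, Finset.prod_pair hab] using isCubicForm_monomial a a b
  · obtain ⟨a, b, c, hab, hac, hbc, rfl⟩ := Finset.card_eq_three.mp ht.2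
    simpa [Finset.prod_insert, hab, hac, hbc, mul_assoc] using isCubicForm_monomial a b c

/-- The sum of the first three elementary symmetric functions, which vanishes exactly on the
vectors of weight divisible by `4`. -/
def completeCubic (x : Fin n → ZMod 2) : ZMod 2 :=
  (bitWeight x).choose 1 + (bitWeight x).choose 2 + (bitWeight x).choose 3

theorem isCubicForm_completeCubic : IsCubicForm (completeCubic (n := n)) :=
  ((isCubicForm_choose_bitWeight le_rfl (by norm_num)).add
    (isCubicForm_choose_bitWeight (by norm_num) (by norm_num))).add
    (isCubicForm_choose_bitWeight (by norm_num) le_rfl)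

/-- The parity is 4-periodic in w, and the values at 1, 2, 3 are 1, 3, 7. -/
theorem choose_sum_cast_eq_one {w : ℕ} (hw : w % 4 ≠ 0) :
    (w.choose 1 + w.choose 2 + w.choose 3 : ZMod 2) = 1 := by
  have per : ∀ m : ℕ, ((m + 4).choose 1 + (m + 4).choose 2 + (m + 4).choose 3 : ZMod 2)
      = m.choose 1 + m.choose 2 + m.choose 3 := by
    intro m
    have h2 : (2 : ZMod 2) = 0 := rfl
    have e : (m + 4).choose 1 + (m + 4).choose 2 + (m + 4).choose 3
        = m.choose 1 + m.choose 2 + m.choose 3 + 2 * (7 + 5 * m.choose 1 + 2 * m.choose 2) := by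
      simp only [Nat.choose_succ_succ', Nat.choose_zero_right]
      ring
    have := congrArg (Nat.cast (R := ZMod 2)) e
    push_cast at this
    rw [this, h2, zero_mul, add_zero]
  induction w using Nat.strong_induction_on with
  | _ w ih =>
    by_cases h : w < 4
    · interval_cases w
      · simp at hw
      all_goals decide
    · obtain ⟨m, rfl⟩ := Nat.exists_eq_add_of_le' (not_lt.mp h)
      rw [per]
      exact ih m (by omega) (by omega)

theorem completeCubic_eq_one {x : Fin n → ZMod 2} (h : bitWeight x % 4 ≠ 0) :
    completeCubic x = 1 :=
  choose_sum_cast_eq_one h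

theorem exists_finset_of_family {α : (Fin n → ZMod 2) → ZMod 2} (hα : IsCubicForm α)
    {κ : Type*} [Fintype κ] (f : κ → Fin n → ZMod 2) (hf : ∀ i j, i ≠ j → α (f i + f j) = 1) :
    ∃ A : Finset (Fin n → ZMod 2), (∀ x ∈ A, ∀ x' ∈ A, x ≠ x' → α (x + x') = 1) ∧
      A.card = Fintype.card κ := by
  classical
  refine ⟨Finset.univ.image f, ?_, ?_⟩
  · simp only [Finset.mem_image, Finset.mem_univ, true_and]
    rintro _ ⟨i, rfl⟩ _ ⟨j, rfl⟩ hij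
    exact hf i j fun h => hij (h ▸ rfl)
  · refine Finset.card_image_of_injective _ fun i j hij => ?_
    by_contra h
    have := hf i j h
    rw [hij, binary_add_self, hα.map_zero] at this
    exact zero_ne_one this

/-- The set is p together with p + w. The case i = j of `hw` separates a point from its own
translate. -/
theorem exists_finset_of_translate {κ : Type*} [Fintype κ] (p : κ → Fin n → ZMod 2)
    (w : Fin n → ZMod 2) (hp : ∀ i j, i ≠ j → bitWeight (p i + p j) % 4 ≠ 0)
    (hw : ∀ i j, bitWeight (p i + p j + w) % 4 ≠ 0) :
    ∃ A : Finset (Fin n → ZMod 2),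
      (∀ x ∈ A, ∀ x' ∈ A, x ≠ x' → completeCubic (x + x') = 1) ∧
      A.card = 2 * Fintype.card κ := by
  have := exists_finset_of_family isCubicForm_completeCubic
    (Sum.elim p fun i => p i + w) (by
      rintro (i | i) (j | j) hij <;> apply completeCubic_eq_one
      · exact hp i j fun h => hij (h ▸ rfl)
      · simpa [add_assoc] using hw i j
      · simpa [add_right_comm] using hw i j
      · simp only [Sum.elim_inr]
        rw [add_add_add_comm, binary_add_self, add_zero]
        exact hp i j fun h => hij (h ▸ rfl))
  rwa [Fintype.card_sum, ← two_mul] at this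

theorem bitWeight_single_add_single {i j : Fin n} (h : i ≠ j) :
    bitWeight (Pi.single i 1 + Pi.single j 1 : Fin n → ZMod 2) = 2 := by
  have e := bitWeight_add (Pi.single i 1 : Fin n → ZMod 2) (Pi.single j 1)
  have : (Pi.single i 1 * Pi.single j 1 : Fin n → ZMod 2) = 0 := by
    ext k
    by_cases hk : k = i
    · subst hk; simp [h]
    · simp [hk]
  rw [this, bitWeight_zero, bitWeight_single, bitWeight_single] at e
  omega

/-- With w a unit vector, sums within a half have weight 2 and sums across have odd weight. -/
theorem exists_two_mul (hn : 1 ≤ n) : ∃ A : Finset (Fin n → ZMod 2),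
    (∀ x ∈ A, ∀ x' ∈ A, x ≠ x' → completeCubic (x + x') = 1) ∧ A.card = 2 * n := by
  have := exists_finset_of_translate (fun i : Fin n => (Pi.single i 1 : Fin n → ZMod 2))
    (Pi.single ⟨0, hn⟩ 1) (fun i j h => by rw [bitWeight_single_add_single h]; norm_num)
    (fun i j => by
      have e1 := bitWeight_add (Pi.single i 1 : Fin n → ZMod 2) (Pi.single j 1)
      have e2 := bitWeight_add (Pi.single i 1 + Pi.single j 1 : Fin n → ZMod 2)
        (Pi.single ⟨0, hn⟩ 1)
      rw [bitWeight_single] at e1 e2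
      rw [bitWeight_single] at e1
      omega)
  simpa using this

/-- With w the all-ones vector, sums across the halves have weight n, n - 1 or n - 2, none divisible
by 4. -/
theorem exists_two_mul_add_two (hn : n % 4 = 3) : ∃ A : Finset (Fin n → ZMod 2),
    (∀ x ∈ A, ∀ x' ∈ A, x ≠ x' → completeCubic (x + x') = 1) ∧ A.card = 2 * n + 2 := by
  have hone : bitWeight (1 : Fin n → ZMod 2) = n := by simp [bitWeight, ZMod.val_one]
  have hsing : ∀ i : Fin n, bitWeight (Pi.single i 1 + 1 : Fin n → ZMod 2) % 4 = 2 := by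
    intro i
    have e := bitWeight_add (Pi.single i 1 : Fin n → ZMod 2) 1
    rw [mul_one, bitWeight_single, hone] at e
    omega
  have := exists_finset_of_translate
    (fun i : Option (Fin n) => (i.elim 0 fun i => Pi.single i 1 : Fin n → ZMod 2)) 1
    (by
      rintro (_ | i) (_ | j) h
      · exact absurd rfl h
      · simp [bitWeight_single]
      · simp [bitWeight_single]
      · simp only [Option.elim_some]
        rw [bitWeight_single_add_single fun e => h (congrArg some e)]
        norm_num)
    (by
      rintro (_ | i) (_ | j)
      · simp [hone, hn]
      · simp [hsing]
      · simp [hsing]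
      · simp only [Option.elim_some]
        have e1 := bitWeight_add (Pi.single i 1 : Fin n → ZMod 2) (Pi.single j 1)
        have e2 := bitWeight_add (Pi.single i 1 + Pi.single j 1 : Fin n → ZMod 2) 1
        rw [bitWeight_single, bitWeight_single] at e1
        rw [hone] at e2
        omega)
  simpa [mul_add] using this

end construction

theorem theorem2 :
    (∀ (n : ℕ) (α : (Fin n → ZMod 2) → ZMod 2) (A : Finset (Fin n → ZMod 2)),
      IsCubicForm α →
      (∀ x ∈ A, ∀ x' ∈ A, x ≠ x' → α (x + x') = 1) →
      A.card ≤ hurwitzRadon (2 ^ n)) ∧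
    (∀ n : ℕ, (n % 4 = 1 ∨ n % 4 = 2 ∨ n % 4 = 3) →
      ∃ (α : (Fin n → ZMod 2) → ZMod 2) (A : Finset (Fin n → ZMod 2)),
        IsCubicForm α ∧
        (∀ x ∈ A, ∀ x' ∈ A, x ≠ x' → α (x + x') = 1) ∧
        A.card = hurwitzRadon (2 ^ n)) := by
  refine ⟨fun n α A hα hA => card_le_hurwitzRadon hα hA, fun n hn => ?_⟩
  refine ⟨completeCubic, ?_⟩
  have hρ : hurwitzRadon (2 ^ n) = if n % 4 = 3 then 2 * n + 2 else 2 * n := by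
    simp only [hurwitzRadon, padicValNat.prime_pow]
    split_ifs <;> omega
  by_cases h3 : n % 4 = 3
  · obtain ⟨A, hA, hcard⟩ := exists_two_mul_add_two h3
    exact ⟨A, isCubicForm_completeCubic, hA, by rw [hcard, hρ, if_pos h3]⟩
  · obtain ⟨A, hA, hcard⟩ := exists_two_mul (n := n) (by omega)
    exact ⟨A, isCubicForm_completeCubic, hA, by rw [hcard, hρ, if_neg h3]⟩
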